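/- For real numbers $\gamma>0$ and integers $j\ge 0$, $n \ge 1$, let $\pi$ be a uniformly random permutation of $[n]=\{1,\dots,n\}$ and let $X^{(n)}_\gamma(\pi)$ be the number of cycles of $\pi$ (fixed points included) with length in the interval $[\gamma n,n]$. Then for every $j\ge 0$ and every $\gamma>0$ the limit \[ P_j(\gamma)=\lim_{n\to\infty}\mathbb P\bigl(X^{(n)}_\gamma=j\bigr) \] exists, and the function $P_j:(0,\infty)\to\mathbb R$ has the following regularity. For every integer $k\ge 1$ with $k\ge j$, $P_j$ is $C^{k-1}$ but not $C^k$ at $\gamma=1/k$. At every other point $\gamma\in(0,\infty)$, that is, at every $\gamma>0$ which is not of the form $1/k$ with $k\ge\max(j,1)$ an integer, $P_j$ is $C^\infty$. (Here $C^m$ at a point means $m$ times continuously differentiable in a neighbourhood of that point, and $C^\infty$ at a point means $C^m$ at that point for every $m$.) -/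

import Mathlib

open Filter Topology
open scoped ContDiff Nat

namespace LongCycles

noncomputable section

open scoped Classical in
/-- The number of cycles of the permutation `σ` of `[n]` whose length lies in `[γ n, δ n]`.
The parts of `σ.partition` are the lengths of all the cycles of `σ`, with multiplicity and
with fixed points counted as cycles of length one. -/
def numCycles {n : ℕ} (γ δ : ℝ) (σ : Equiv.Perm (Fin n)) : ℕ :=
  σ.partition.parts.countP (fun m : ℕ => γ * n ≤ (m : ℝ) ∧ (m : ℝ) ≤ δ * n)

/-- The probability that a uniformly random permutation of `[n]` has exactly `i` cycles of
length in `[γ n, δ n]`. -/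
def cycleProb (n i : ℕ) (γ δ : ℝ) : ℝ :=
  (Finset.card {σ : Equiv.Perm (Fin n) | numCycles γ δ σ = i} : ℝ) / (n ! : ℝ)

/-- The limiting probability `p_i(γ, δ)` of having exactly `i` cycles of length
in `[γ n, δ n]`. -/
def p (i : ℕ) (γ δ : ℝ) : ℝ :=
  limUnder atTop (fun n : ℕ => cycleProb n i γ δ)

/-- The limiting probability `P_j(γ) = p_j(γ, 1)` of having exactly `j` cycles of length at
least `γ n`. -/
def P (j : ℕ) (γ : ℝ) : ℝ := p j γ 1

end

end LongCycles

/-! Fix m and let G_n be the generating function of the number of cycles of length at least m. The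
cycle through a random element has uniform length and the rest is a uniform permutation, so n G_n is
a sum of the G_(n-l), weighted by X when l ≥ m. Subtracting consecutive instances gives
(n+1)(G_(n+1) - G_n) = (X-1) G_(n+1-m) for m ≤ n+1 (`longCycleGenFun_succ`). Iteration expands G_n
in powers of X-1, with the binomial moments as coefficients; those with rm > n vanish
(`longCycleGenFun_eq_sum`).

With m = ⌈γn⌉ and u = n/m, the recursion for the moments discretizes f_(r+1)(u) = ∫_1^u f_r(s-1)/s
ds, where f_0 is the indicator of u ≥ 0 (`limitMoment`). The moments converge
(`exists_abs_binomialMoment_sub_le`), so P_j(γ) is the finite sum of (-1)^(r-j) (r choose j)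
f_r(1/γ).

The jump of f_0 at 0 moves right by one and gains one derivative with each integration: for r ≥ 1,
f_r is smooth off r, and C^(r-1) but not C^r at r. At γ = 1/k only f_k is singular, and its
coefficient is nonzero exactly when k ≥ j. -/

namespace LongCycles

open Polynomial

/-! ### Counting permutations by cycle lengths -/

/-- The order of the centralizer of a permutation whose cycle lengths, fixed points included,
form the multiset `s`. -/
def centralizerOrder (s : Multiset ℕ) : ℕ :=
  s.prod * ∏ i ∈ s.toFinset, (s.count i)!

lemma centralizerOrder_eq_prod_subset (s : Multiset ℕ) {t : Finset ℕ} (h : s.toFinset ⊆ t) :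
    centralizerOrder s = s.prod * ∏ i ∈ t, (s.count i)! := by
  rw [centralizerOrder, Finset.prod_subset h]
  intro i _ hi
  rw [Multiset.count_eq_zero.2 (by simpa using hi), Nat.factorial_zero]

lemma centralizerOrder_cons (a : ℕ) (s : Multiset ℕ) :
    centralizerOrder (a ::ₘ s) = a * (a ::ₘ s).count a * centralizerOrder s := by
  have h1 : insert a s.toFinset = insert a (s.toFinset.erase a) := by
    ext i; simp; tauto
  rw [centralizerOrder_eq_prod_subset (a ::ₘ s) (t := insert a s.toFinset) (by simp),
    centralizerOrder_eq_prod_subset s (Finset.subset_insert a _), h1,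
    Finset.prod_insert (by simp), Finset.prod_insert (by simp), Multiset.prod_cons,
    Multiset.count_cons_self, Nat.factorial_succ]
  rw [Finset.prod_congr rfl fun i hi => by
    rw [Multiset.count_cons_of_ne (Finset.ne_of_mem_erase hi)]]
  ring

lemma centralizerOrder_pos {s : Multiset ℕ} (h : ∀ i ∈ s, 0 < i) : 0 < centralizerOrder s :=
  Nat.mul_pos (Multiset.prod_pos h) (Finset.prod_pos fun _ _ => Nat.factorial_pos _)

lemma centralizerOrder_add_replicate_one {s : Multiset ℕ} (h : 1 ∉ s) (k : ℕ) :
    centralizerOrder (s + Multiset.replicate k 1) = k ! * centralizerOrder s := by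
  induction k with
  | zero => simp
  | succ k ih =>
    rw [Multiset.replicate_succ, Multiset.add_cons, centralizerOrder_cons, ih,
      Nat.factorial_succ]
    simp [Multiset.count_eq_zero.2 h]
    ring

/-- `Equiv.Perm.cycleType` omits fixed points. The k parts equal to 1 restore them: they contribute
exactly the factor k! for the fixed points in the count by cycle type. -/
lemma card_partition_eq_mul {α : Type*} [Fintype α] [DecidableEq α]
    (q : (Fintype.card α).Partition) :
    Finset.card {σ : Equiv.Perm α | σ.partition = q} * centralizerOrder q.parts =
      (Fintype.card α)! := by
  set m := q.parts.filter (2 ≤ ·) with hm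
  have hcompl : q.parts.filter (¬ 2 ≤ ·) =
      Multiset.replicate (q.parts.filter (¬ 2 ≤ ·)).card 1 := by
    rw [Multiset.eq_replicate_card]
    intro b hb
    rw [Multiset.mem_filter] at hb
    have := q.parts_pos hb.1
    omega
  have hparts := Multiset.filter_add_not (2 ≤ ·) q.parts
  rw [← hm] at hparts
  set k := (q.parts.filter (¬ 2 ≤ ·)).card
  rw [hcompl] at hparts
  have hsum : m.sum + k = Fintype.card α := by
    rw [← q.parts_sum, ← hparts]; simp
  have h2 : ∀ a ∈ m, 2 ≤ a := fun a ha => (Multiset.mem_filter.1 ha).2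
  have h1 : 1 ∉ m := fun h => by simpa using h2 1 h
  have hset : ({σ : Equiv.Perm α | σ.partition = q} : Finset _) =
      ({σ : Equiv.Perm α | σ.cycleType = m} : Finset _) := by
    ext σ
    simp only [Finset.mem_filter, Finset.mem_univ, true_and]
    constructor
    · rintro rfl
      rw [hm, Equiv.Perm.filter_parts_partition_eq_cycleType]
    · intro h
      rw [Nat.Partition.ext_iff, Equiv.Perm.parts_partition, ← Equiv.Perm.sum_cycleType, h,
        ← hparts]
      congr 2
      omega
  have key := Equiv.Perm.card_of_cycleType_mul_eq α m
  rw [if_pos ⟨by omega, h2⟩] at key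
  rw [hset, ← hparts, centralizerOrder_add_replicate_one h1, ← key, centralizerOrder]
  rw [show Fintype.card α - m.sum = k by omega]
  ring

/-! ### Means over random permutations -/

variable {E : Type*} [AddCommGroup E] [Module ℝ E]

/-- The mean of `F (cycle lengths of σ)` over uniformly random permutations `σ` of `[n]`. -/
noncomputable def cycleMean (n : ℕ) (F : Multiset ℕ → E) : E :=
  ∑ q : n.Partition, (centralizerOrder q.parts : ℝ)⁻¹ • F q.parts

lemma sum_perm_eq_cycleMean {α : Type*} [Fintype α] [DecidableEq α] (F : Multiset ℕ → E) :
    ∑ σ : Equiv.Perm α, F σ.partition.parts =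
      ((Fintype.card α)! : ℝ) • cycleMean (Fintype.card α) F := by
  rw [← Finset.sum_fiberwise_of_maps_to (t := Finset.univ)
    (g := fun σ : Equiv.Perm α => σ.partition) (fun _ _ => Finset.mem_univ _), cycleMean,
    Finset.smul_sum]
  refine Finset.sum_congr rfl fun q _ => ?_
  have h0 : (centralizerOrder q.parts : ℝ) ≠ 0 := by
    exact_mod_cast (centralizerOrder_pos fun i hi => q.parts_pos hi).ne'
  rw [Finset.sum_congr rfl (g := fun _ => F q.parts) fun σ hσ => by
    rw [(Finset.mem_filter.1 hσ).2], Finset.sum_const, smul_smul, ← card_partition_eq_mul q]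
  push_cast
  rw [mul_inv_cancel_right₀ h0, Nat.cast_smul_eq_nsmul]

/-- Write n as the sum of count(l) * l over the distinct parts l. Erasing one part l divides the
centralizer order by exactly count(l) * l, so the weights cancel. -/
lemma nat_smul_cycleMean (n : ℕ) (F : Multiset ℕ → E) :
    (n : ℝ) • cycleMean n F =
      ∑ l ∈ Finset.Icc 1 n, cycleMean (n - l) fun s => F (l ::ₘ s) := by
  have h1 : ∀ q : n.Partition, (n : ℝ) • (centralizerOrder q.parts : ℝ)⁻¹ • F q.parts =
      ∑ l ∈ q.parts.toFinset,
        (centralizerOrder (q.parts.erase l) : ℝ)⁻¹ • F (l ::ₘ q.parts.erase l) := by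
    intro q
    have hn : n = ∑ l ∈ q.parts.toFinset, q.parts.count l * l := by
      conv_lhs => rw [← q.parts_sum, Finset.sum_multiset_count]
      simp
    have hn' : (n : ℝ) = ∑ l ∈ q.parts.toFinset, ((q.parts.count l * l : ℕ) : ℝ) := by
      rw [← Nat.cast_sum, ← hn]
    rw [hn', Finset.sum_smul]
    refine Finset.sum_congr rfl fun l hl => ?_
    have hl' : l ∈ q.parts := by simpa using hl
    have hl0 := q.parts_pos hl'
    have hc := Multiset.count_pos.2 hl'
    have hz := centralizerOrder_cons l (q.parts.erase l)
    rw [Multiset.cons_erase hl'] at hz ⊢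
    rw [hz, smul_smul]
    congr 1
    push_cast
    have : (0 : ℝ) < l := by exact_mod_cast hl0
    have : (0 : ℝ) < q.parts.count l := by exact_mod_cast hc
    rw [mul_inv, mul_inv]
    field_simp
  rw [cycleMean, Finset.smul_sum, Finset.sum_congr rfl fun q _ => h1 q]
  simp only [cycleMean]
  rw [Finset.sum_sigma', Finset.sum_sigma']
  refine Finset.sum_bij'
    (i := fun x hx => ⟨x.2, ⟨x.1.parts.erase x.2,
      fun {i} hi => x.1.parts_pos (Multiset.mem_of_mem_erase hi), ?_⟩⟩)
    (j := fun y hy => ⟨⟨y.1 ::ₘ y.2.parts, ?_, ?_⟩, y.1⟩) ?_ ?_ ?_ ?_ ?_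
  · have h : x.2 ∈ x.1.parts := by simpa using hx
    have := x.1.parts_sum
    rw [← Multiset.cons_erase h, Multiset.sum_cons] at this
    omega
  · intro i hi
    rcases Multiset.mem_cons.1 hi with rfl | hi
    · simp at hy; omega
    · exact y.2.parts_pos hi
  · simp at hy
    rw [Multiset.sum_cons, y.2.parts_sum]; omega
  · rintro ⟨q, l⟩ hx
    have h : l ∈ q.parts := by simpa using hx
    simpa using ⟨q.parts_pos h, q.le_of_mem_parts h⟩
  · rintro ⟨l, q⟩ hy
    simp
  · rintro ⟨q, l⟩ hx
    have h : l ∈ q.parts := by simpa using hx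
    simp [Multiset.cons_erase h]
  · rintro ⟨l, q⟩ hy
    simp
  · rintro ⟨q, l⟩ hx
    rfl

/-! ### The generating function and its delay recursion -/

/-- The probability generating function of the number of cycles of length at least `m` of a
uniformly random permutation of `[n]`. -/
noncomputable def longCycleGenFun (m n : ℕ) : ℝ[X] :=
  cycleMean n fun s => (X : ℝ[X]) ^ s.countP (m ≤ ·)

lemma cycleMean_mul (n : ℕ) (p : ℝ[X]) (F : Multiset ℕ → ℝ[X]) :
    cycleMean n (fun s => p * F s) = p * cycleMean n F := by
  simp [cycleMean, Finset.mul_sum]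

lemma nat_smul_longCycleGenFun (m n : ℕ) :
    (n : ℝ) • longCycleGenFun m n =
      ∑ l ∈ Finset.Icc 1 n, (if m ≤ l then X else 1) * longCycleGenFun m (n - l) := by
  rw [longCycleGenFun, nat_smul_cycleMean]
  refine Finset.sum_congr rfl fun l _ => ?_
  rw [longCycleGenFun, ← cycleMean_mul]
  congr 1
  ext1 s
  rw [Multiset.countP_cons, pow_add, mul_comm]
  split_ifs <;> simp

lemma longCycleGenFun_zero (m : ℕ) : longCycleGenFun m 0 = 1 := by
  simp [longCycleGenFun, cycleMean, centralizerOrder]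

lemma nat_smul_longCycleGenFun_eq_sum_range {m : ℕ} (hm : 0 < m) (n : ℕ) :
    (n : ℝ) • longCycleGenFun m n = ∑ i ∈ Finset.range n, longCycleGenFun m i +
      (X - 1) * ∑ i ∈ Finset.range (n + 1 - m), longCycleGenFun m i := by
  have h1 : ∑ i ∈ Finset.range (n + 1 - m), longCycleGenFun m i =
      ∑ i ∈ Finset.range n, if m ≤ n - i then longCycleGenFun m i else 0 := by
    rw [← Finset.sum_filter]
    refine Finset.sum_congr ?_ fun _ _ => rfl
    ext i; simp; omega
  rw [nat_smul_longCycleGenFun, h1, Finset.mul_sum, ← Finset.sum_add_distrib]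
  refine Finset.sum_bij' (i := fun l _ => n - l) (j := fun i _ => n - i) ?_ ?_ ?_ ?_ ?_
  · intro l hl; simp at hl ⊢; omega
  · intro l hl; simp at hl ⊢; omega
  · intro l hl; simp at hl ⊢; omega
  · intro l hl; simp at hl ⊢; omega
  · intro l hl
    simp only [Finset.mem_Icc] at hl
    rw [show n - (n - l) = l by omega]
    split_ifs <;> ring

lemma longCycleGenFun_succ {m : ℕ} (hm : 0 < m) (n : ℕ) :
    longCycleGenFun m (n + 1) = longCycleGenFun m n +
      if m ≤ n + 1 then (n + 1 : ℝ)⁻¹ • ((X - 1) * longCycleGenFun m (n + 1 - m)) else 0 := by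
  have h0 : ((n : ℝ) + 1) ≠ 0 := by positivity
  have e1 := nat_smul_longCycleGenFun_eq_sum_range hm n
  have e2 := nat_smul_longCycleGenFun_eq_sum_range hm (n + 1)
  rw [Finset.sum_range_succ] at e2
  apply smul_right_injective _ h0
  simp only
  push_cast at e2
  rw [e2, smul_add, add_smul, one_smul, e1]
  split_ifs with h
  · rw [smul_smul, mul_inv_cancel₀ h0, one_smul, show n + 1 + 1 - m = (n + 1 - m) + 1 by omega,
      Finset.sum_range_succ]
    ring
  · rw [show n + 1 + 1 - m = 0 by omega, show n + 1 - m = 0 by omega]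
    simp

/-! ### Binomial moments and inclusion-exclusion -/

/-- The mean number of `r`-element sets of cycles of length at least `m` in a uniformly random
permutation of `[n]`. -/
noncomputable def binomialMoment (m : ℕ) : ℕ → ℕ → ℝ
  | 0, _ => 1
  | r + 1, n => ∑ k ∈ Finset.range n,
      if m ≤ k + 1 then (k + 1 : ℝ)⁻¹ * binomialMoment m r (k + 1 - m) else 0

lemma binomialMoment_eq_zero (m : ℕ) {r n : ℕ} (h : n < r * m) : binomialMoment m r n = 0 := by
  induction r generalizing n with
  | zero => simp at h
  | succ r ih =>
    refine Finset.sum_eq_zero fun k hk => ?_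
    split_ifs with hm
    · rw [ih, mul_zero]
      simp at hk
      rw [add_mul] at h
      omega
    · rfl

/-- Each delayed term in `longCycleGenFun_succ` brings one factor X-1 and uses up m of n, so it
raises r by one and lowers the required R by one. -/
lemma longCycleGenFun_eq_sum {m : ℕ} (hm : 0 < m) {R : ℕ} {n : ℕ} (h : n < R * m) :
    longCycleGenFun m n =
      ∑ r ∈ Finset.range R, C (binomialMoment m r n) * (X - 1) ^ r := by
  induction n using Nat.strong_induction_on generalizing R with
  | _ n ih =>
  obtain ⟨R, rfl⟩ : ∃ R', R = R' + 1 := Nat.exists_eq_succ_of_ne_zero (by rintro rfl; simp at h)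
  rcases n with _ | n
  · rw [longCycleGenFun_zero, Finset.sum_range_succ', Finset.sum_eq_zero]
    · simp [binomialMoment]
    · intro r _; simp [binomialMoment]
  · rw [longCycleGenFun_succ hm, ih n (by omega) (R := R + 1) (by omega),
      Finset.sum_range_succ', Finset.sum_range_succ' (n := R)]
    simp only [binomialMoment, Finset.sum_range_succ, map_add, add_mul, Finset.sum_add_distrib]
    rw [add_right_comm]
    congr 2
    split_ifs with hmn
    · rw [ih (n + 1 - m) (by omega) (R := R) (by rw [add_mul] at h; omega), Finset.mul_sum,
        Finset.smul_sum]
      refine Finset.sum_congr rfl fun r _ => ?_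
      rw [smul_eq_C_mul, map_mul]
      ring
    · simp

lemma cycleProb_eq_coeff (n j : ℕ) (γ : ℝ) :
    cycleProb n j γ 1 = (longCycleGenFun ⌈γ * n⌉₊ n).coeff j := by
  have h1 : ∀ σ : Equiv.Perm (Fin n),
      numCycles γ 1 σ = σ.partition.parts.countP (⌈γ * n⌉₊ ≤ ·) := by
    intro σ
    unfold numCycles
    refine Multiset.countP_congr rfl fun k hk => ?_
    -- The upper bound 1 * n holds for every cycle.
    have := σ.partition.le_of_mem_parts hk
    rw [Fintype.card_fin] at this
    simp [Nat.ceil_le, this]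
  have h2 := congrArg (fun p => p.coeff j) (sum_perm_eq_cycleMean (α := Fin n)
    fun s => (X : ℝ[X]) ^ s.countP (⌈γ * n⌉₊ ≤ ·))
  simp only [finsetSum_coeff, coeff_X_pow, coeff_smul] at h2
  rw [cycleProb, div_eq_iff (by positivity), mul_comm, longCycleGenFun, Finset.card_filter]
  have h3 : (Fintype.card (Fin n))! = n ! := by simp
  have h4 : (cycleMean (Fintype.card (Fin n)) fun s => (X : ℝ[X]) ^ s.countP (⌈γ * n⌉₊ ≤ ·)) =
    cycleMean n fun s => (X : ℝ[X]) ^ s.countP (⌈γ * n⌉₊ ≤ ·) := by rw [Fintype.card_fin]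
  rw [h3, h4, smul_eq_mul] at h2
  rw [← h2]
  push_cast
  refine Finset.sum_congr rfl fun σ _ => ?_
  rw [h1]
  simp only [eq_comm]

/-- The number R of terms does not depend on n, so the limit can be taken termwise. The truncated
exponent r - j is harmless, since the binomial coefficient vanishes for r < j. -/
lemma cycleProb_eq_sum {n j R : ℕ} {γ : ℝ} (hn : 0 < n) (hγ : 0 < γ) (hR : 1 < R * γ) :
    cycleProb n j γ 1 = ∑ r ∈ Finset.range R,
      (-1) ^ (r - j) * (r.choose j : ℝ) * binomialMoment ⌈γ * n⌉₊ r n := by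
  have hn' : (0 : ℝ) < n := by exact_mod_cast hn
  have h : n < R * ⌈γ * n⌉₊ := by
    have h1 : (n : ℝ) < R * (γ * n) := by nlinarith
    have h2 : (R : ℝ) * (γ * n) ≤ R * ⌈γ * n⌉₊ := by gcongr; exact Nat.le_ceil _
    exact_mod_cast h1.trans_le h2
  rw [cycleProb_eq_coeff, longCycleGenFun_eq_sum (Nat.ceil_pos.2 (by positivity)) h,
    finsetSum_coeff]
  refine Finset.sum_congr rfl fun r _ => ?_
  rw [coeff_C_mul, show (X - 1 : ℝ[X]) = X + C (-1) by simp [sub_eq_add_neg],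
    coeff_X_add_C_pow]
  ring

end LongCycles

namespace LongCycles

open MeasureTheory

/-! ### The limiting delay integral equation -/

/-- The limit, as `n → ∞`, of the mean number of `r`-element sets of cycles of length at least
`n / u` in a uniformly random permutation of `[n]`. -/
noncomputable def limitMoment : ℕ → ℝ → ℝ
  | 0, u => if 0 ≤ u then 1 else 0
  | r + 1, u => ∫ s in (1 : ℝ)..u, limitMoment r (s - 1) / s

lemma limitMoment_succ (r : ℕ) (u : ℝ) :
    limitMoment (r + 1) u = ∫ s in (1 : ℝ)..u, limitMoment r (s - 1) / s := rfl

lemma limitMoment_zero_of_nonneg {u : ℝ} (h : 0 ≤ u) : limitMoment 0 u = 1 := if_pos h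

lemma limitMoment_of_lt {r : ℕ} {u : ℝ} (h : u < r) : limitMoment r u = 0 := by
  induction r generalizing u with
  | zero => exact if_neg (by simpa using h)
  | succ r ih =>
    push_cast at h
    rw [limitMoment_succ]
    refine intervalIntegral.integral_zero_ae ?_
    filter_upwards [compl_mem_ae_iff.2 (measure_singleton (1 : ℝ))] with s hs1 hs
    rw [ih, zero_div]
    have hs1 : s ≠ 1 := hs1
    rcases le_total u 1 with hu | hu
    · rw [Set.uIoc_of_ge hu] at hs
      have : s < 1 := lt_of_le_of_ne hs.2 hs1
      have : (0 : ℝ) ≤ r := r.cast_nonneg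
      linarith
    · rw [Set.uIoc_of_le hu] at hs
      linarith [hs.2]

/-- The numerator vanishes for s < 1, so 1/s may be replaced by a factor continuous on the whole
line. -/
lemma limitMoment_sub_one_div (r : ℕ) (s : ℝ) :
    limitMoment r (s - 1) / s = limitMoment r (s - 1) * (max s 1)⁻¹ := by
  rcases lt_or_ge s 1 with h | h
  · rw [limitMoment_of_lt, zero_div, zero_mul]
    have : (0 : ℝ) ≤ r := r.cast_nonneg
    linarith
  · rw [max_eq_left h, div_eq_mul_inv]

lemma continuous_limitMoment_succ_of_intervalIntegrable {r : ℕ}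
    (h : ∀ a b, IntervalIntegrable (limitMoment r) volume a b) :
    (∀ a b, IntervalIntegrable (fun s => limitMoment r (s - 1) / s) volume a b) ∧
      Continuous (limitMoment (r + 1)) := by
  have h1 : ∀ a b, IntervalIntegrable (fun s => limitMoment r (s - 1) / s) volume a b := by
    intro a b
    simp only [limitMoment_sub_one_div]
    refine IntervalIntegrable.mul_continuousOn ?_ ?_
    · simpa using (h (a - 1) (b - 1)).comp_sub_right 1
    · refine Continuous.continuousOn (Continuous.inv₀ (by fun_prop) fun x => ?_)
      exact (lt_of_lt_of_le one_pos (le_max_right x 1)).ne'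
  exact ⟨h1, intervalIntegral.continuous_primitive h1 1⟩

lemma intervalIntegrable_limitMoment (r : ℕ) (a b : ℝ) :
    IntervalIntegrable (limitMoment r) volume a b := by
  induction r generalizing a b with
  | zero =>
    refine Monotone.intervalIntegrable fun x y hxy => ?_
    unfold limitMoment
    split_ifs <;> linarith
  | succ r ih =>
    exact (continuous_limitMoment_succ_of_intervalIntegrable ih).2.intervalIntegrable a b

lemma intervalIntegrable_limitMoment_div (r : ℕ) (a b : ℝ) :
    IntervalIntegrable (fun s => limitMoment r (s - 1) / s) volume a b :=
  (continuous_limitMoment_succ_of_intervalIntegrable (intervalIntegrable_limitMoment r)).1 a b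

lemma continuous_limitMoment_succ (r : ℕ) : Continuous (limitMoment (r + 1)) :=
  (continuous_limitMoment_succ_of_intervalIntegrable (intervalIntegrable_limitMoment r)).2

/-! ### Regularity of the limit moments -/

lemma limitMoment_zero_eventuallyEq {u : ℝ} (h : 0 < u) : limitMoment 0 =ᶠ[𝓝 u] fun _ => 1 := by
  filter_upwards [lt_mem_nhds h] with v hv using limitMoment_zero_of_nonneg hv.le

lemma limitMoment_eventuallyEq_zero {r : ℕ} {u : ℝ} (h : u < r) :
    limitMoment r =ᶠ[𝓝 u] fun _ => 0 := by
  filter_upwards [gt_mem_nhds h] with v hv using limitMoment_of_lt hv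

lemma continuousAt_limitMoment (r : ℕ) {u : ℝ} (h : 0 < u) : ContinuousAt (limitMoment r) u := by
  rcases r with _ | r
  · exact continuousAt_const.congr (limitMoment_zero_eventuallyEq h).symm
  · exact (continuous_limitMoment_succ r).continuousAt

lemma measurable_limitMoment (r : ℕ) : Measurable (limitMoment r) := by
  rcases r with _ | r
  · exact Measurable.ite measurableSet_Ici measurable_const measurable_const
  · exact (continuous_limitMoment_succ r).measurable

lemma hasDerivAt_limitMoment_succ {r : ℕ} {u : ℝ} (hu : 0 < u)
    (h : ContinuousAt (limitMoment r) (u - 1)) :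
    HasDerivAt (limitMoment (r + 1)) (limitMoment r (u - 1) / u) u := by
  refine intervalIntegral.integral_hasDerivAt_right (intervalIntegrable_limitMoment_div r 1 u)
    ?_ ?_
  · have : Measurable fun s => limitMoment r (s - 1) / s :=
      ((measurable_limitMoment r).comp (measurable_id.sub_const 1)).div measurable_id
    exact this.stronglyMeasurable.stronglyMeasurableAtFilter
  · exact ContinuousAt.div (ContinuousAt.comp (g := limitMoment r) h (by fun_prop))
      continuousAt_id hu.ne'

lemma contDiffAt_succ_of_eventually_hasDerivAt {f g : ℝ → ℝ} {u : ℝ} {n : ℕ}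
    (h : ∀ᶠ v in 𝓝 u, HasDerivAt f (g v) v) (hg : ContDiffAt ℝ n g u) :
    ContDiffAt ℝ (n + 1 : ℕ) f u := by
  push_cast
  rw [contDiffAt_succ_iff_hasFDerivAt]
  refine ⟨fun v => ContinuousLinearMap.toSpanSingleton ℝ (g v),
    ⟨_, h, fun v hv => (show HasDerivAt f (g v) v from hv).hasFDerivAt⟩, ?_⟩
  exact (ContinuousLinearMap.toSpanSingletonCLE (𝕜 := ℝ) (E := ℝ)).contDiff.contDiffAt.comp u hg

lemma contDiffAt_limitMoment_succ {r n : ℕ} {u : ℝ} (hu : 0 < u)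
    (hc : ∀ᶠ v in 𝓝 u, ContinuousAt (limitMoment r) (v - 1))
    (h : ContDiffAt ℝ n (limitMoment r) (u - 1)) :
    ContDiffAt ℝ (n + 1 : ℕ) (limitMoment (r + 1)) u := by
  refine contDiffAt_succ_of_eventually_hasDerivAt
    (g := fun v => limitMoment r (v - 1) / v) ?_ ?_
  · filter_upwards [hc, lt_mem_nhds hu] with v h1 h2 using hasDerivAt_limitMoment_succ h2 h1
  · exact ContDiffAt.div (h.comp (g := limitMoment r) u (by fun_prop)) contDiffAt_id hu.ne'

lemma contDiffAt_limitMoment_of_gt {r : ℕ} {u : ℝ} (h : r < u) (n : ℕ) :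
    ContDiffAt ℝ n (limitMoment r) u := by
  induction r generalizing u n with
  | zero => exact contDiffAt_const.congr_of_eventuallyEq (limitMoment_zero_eventuallyEq (by simpa using h))
  | succ r ih =>
    push_cast at h
    have hr : (0 : ℝ) ≤ r := r.cast_nonneg
    refine ContDiffAt.of_le (contDiffAt_limitMoment_succ (n := n) (by linarith) ?_
      (ih (by linarith) n)) (by exact_mod_cast n.le_succ)
    filter_upwards [lt_mem_nhds h] with v hv
    exact continuousAt_limitMoment r (by linarith)

lemma contDiffAt_limitMoment_of_ne {r : ℕ} {u : ℝ} (h : u ≠ r) :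
    ContDiffAt ℝ ∞ (limitMoment r) u := by
  rw [contDiffAt_infty]
  rcases h.lt_or_gt with h | h
  · exact fun n => contDiffAt_const.congr_of_eventuallyEq (limitMoment_eventuallyEq_zero h)
  · exact contDiffAt_limitMoment_of_gt h

lemma contDiffAt_limitMoment_self (r : ℕ) :
    ContDiffAt ℝ r (limitMoment (r + 1)) ((r + 1 : ℕ) : ℝ) := by
  induction r with
  | zero => simpa using! contDiffAt_zero.2 ⟨Set.univ, univ_mem, (continuous_limitMoment_succ 0).continuousOn⟩
  | succ r ih =>
    refine contDiffAt_limitMoment_succ (by positivity)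
      (Eventually.of_forall fun v => (continuous_limitMoment_succ r).continuousAt) ?_
    convert ih using 1
    push_cast; ring

/-- The derivative of the first moment jumps from 0 to 1 at u = 1. Solving the delay equation for
the lower moment, f_r(v) = (v+1) f_(r+1)'(v+1), carries the failure from each r to the next. -/
lemma not_contDiffAt_limitMoment_self (r : ℕ) :
    ¬ ContDiffAt ℝ (r + 1 : ℕ) (limitMoment (r + 1)) ((r + 1 : ℕ) : ℝ) := by
  induction r with
  | zero =>
    intro h
    have hd : DifferentiableAt ℝ (limitMoment 1) 1 := by
      simpa using! h.differentiableAt (by simp)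
    have hlim : Tendsto (deriv (limitMoment 1)) (𝓝 1) (𝓝 (deriv (limitMoment 1) 1)) := by
      have := (ContDiffAt.derivWithin (m := 0) h (by simp)).continuousAt
      simpa [ContinuousAt] using! this
    have h0 : Tendsto (deriv (limitMoment 1)) (𝓝[<] 1) (𝓝 0) := by
      refine tendsto_const_nhds.congr' ?_
      filter_upwards [self_mem_nhdsWithin] with v hv
      rw [(limitMoment_eventuallyEq_zero (r := 1) (by simpa using hv)).deriv_eq, deriv_const]
    have h1 : Tendsto (deriv (limitMoment 1)) (𝓝[>] 1) (𝓝 1) := by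
      have : Tendsto (fun v : ℝ => 1 / v) (𝓝[>] 1) (𝓝 (1 / 1)) :=
        (continuousAt_const.div continuousAt_id one_ne_zero).tendsto.mono_left nhdsWithin_le_nhds
      rw [div_one] at this
      refine this.congr' ?_
      filter_upwards [self_mem_nhdsWithin] with v hv
      have hv : 1 < v := hv
      rw [(hasDerivAt_limitMoment_succ (r := 0) (by linarith)
        (continuousAt_limitMoment 0 (by linarith))).deriv,
        limitMoment_zero_of_nonneg (by linarith)]
    have e0 := tendsto_nhds_unique h0 (hlim.mono_left nhdsWithin_le_nhds)
    have e1 := tendsto_nhds_unique h1 (hlim.mono_left nhdsWithin_le_nhds)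
    linarith
  | succ r ih =>
    intro h
    refine ih ?_
    have hd : ContDiffAt ℝ (r + 1 : ℕ) (deriv (limitMoment (r + 1 + 1)))
        (((r + 1 : ℕ) : ℝ) + 1) := by
      rw [← Nat.cast_succ]
      exact ContDiffAt.derivWithin h (by simp)
    have hm : ContDiffAt ℝ (r + 1 : ℕ)
        (fun v : ℝ => (v + 1) * deriv (limitMoment (r + 1 + 1)) (v + 1)) ((r + 1 : ℕ) : ℝ) :=
      ContDiffAt.mul (by fun_prop)
        (hd.comp (g := deriv (limitMoment (r + 1 + 1))) ((r + 1 : ℕ) : ℝ) (by fun_prop))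
    refine hm.congr_of_eventuallyEq ?_
    have : (0 : ℝ) < (r + 1 : ℕ) := by positivity
    filter_upwards [lt_mem_nhds this] with v hv
    rw [(hasDerivAt_limitMoment_succ (by linarith)
      (continuous_limitMoment_succ r).continuousAt).deriv, add_sub_cancel_right,
      mul_div_cancel₀ _ (by linarith)]

/-! ### Convergence of the binomial moments -/

lemma exists_abs_limitMoment_le (r : ℕ) (U : ℝ) :
    ∃ B, 0 ≤ B ∧ ∀ u ≤ U, |limitMoment r u| ≤ B := by
  induction r generalizing U with
  | zero =>
    refine ⟨1, zero_le_one, fun u _ => ?_⟩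
    unfold limitMoment
    split_ifs <;> simp
  | succ r ih =>
    obtain ⟨B, hB, h⟩ := ih U
    refine ⟨B * |U - 1|, by positivity, fun u hu => ?_⟩
    rcases lt_or_ge u 1 with hu1 | hu1
    · rw [limitMoment_of_lt, abs_zero]
      · positivity
      · push_cast; linarith [(r.cast_nonneg : (0 : ℝ) ≤ r)]
    · rw [limitMoment_succ, ← Real.norm_eq_abs]
      refine (intervalIntegral.norm_integral_le_of_norm_le_const (C := B) ?_).trans ?_
      · intro s hs
        rw [Set.uIoc_of_le hu1] at hs
        rw [Real.norm_eq_abs, abs_div, abs_of_pos (by linarith [hs.1] : 0 < s),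
          div_le_iff₀ (by linarith [hs.1])]
        have := h (s - 1) (by linarith [hs.2])
        nlinarith [hs.1]
      · rw [abs_of_nonneg (by linarith : 0 ≤ u - 1), abs_of_nonneg (by linarith : 0 ≤ U - 1)]
        gcongr

lemma limitMoment_succ_sub (r : ℕ) (a b : ℝ) : limitMoment (r + 1) b - limitMoment (r + 1) a =
    ∫ s in a..b, limitMoment r (s - 1) / s :=
  intervalIntegral.integral_interval_sub_left (intervalIntegrable_limitMoment_div r 1 b)
    (intervalIntegrable_limitMoment_div r 1 a)

lemma exists_lipschitz_limitMoment (r : ℕ) (U : ℝ) :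
    ∃ L, 0 ≤ L ∧ ∀ x y, 0 ≤ x → x ≤ y → y ≤ U →
      |limitMoment r y - limitMoment r x| ≤ L * (y - x) := by
  rcases r with _ | r
  · refine ⟨0, le_rfl, fun x y hx hxy _ => ?_⟩
    rw [limitMoment_zero_of_nonneg hx, limitMoment_zero_of_nonneg (hx.trans hxy)]
    simp
  · obtain ⟨B, hB, h⟩ := exists_abs_limitMoment_le r U
    refine ⟨B, hB, fun x y hx hxy hy => ?_⟩
    rw [limitMoment_succ_sub, ← Real.norm_eq_abs, ← abs_of_nonneg (sub_nonneg.2 hxy)]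
    refine intervalIntegral.norm_integral_le_of_norm_le_const fun s hs => ?_
    rw [Set.uIoc_of_le hxy] at hs
    have hm : 1 ≤ max s 1 := le_max_right _ _
    rw [limitMoment_sub_one_div, Real.norm_eq_abs, abs_mul, abs_of_pos (by positivity : 0 < (max s 1)⁻¹)]
    calc _ ≤ B * 1 := by
          gcongr
          · exact h _ (by linarith [hs.2])
          · exact inv_le_one_of_one_le₀ hm
      _ = B := mul_one B

/-- Right-endpoint rectangle rule: the integrand is Lipschitz. It is applied with b - a = 1/m, one
step of the discrete recursion. -/
lemma exists_limitMoment_succ_approx (r : ℕ) (U : ℝ) :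
    ∃ K, 0 ≤ K ∧ ∀ a b, 1 ≤ a → a ≤ b → b ≤ U →
      |limitMoment (r + 1) b - limitMoment (r + 1) a - (b - a) * (limitMoment r (b - 1) / b)| ≤
        K * (b - a) ^ 2 := by
  obtain ⟨B, hB, hb⟩ := exists_abs_limitMoment_le r U
  obtain ⟨L, hL, hl⟩ := exists_lipschitz_limitMoment r U
  refine ⟨L + B, by positivity, fun a b ha hab hbU => ?_⟩
  have e : limitMoment (r + 1) b - limitMoment (r + 1) a - (b - a) * (limitMoment r (b - 1) / b) =
      ∫ s in a..b, (limitMoment r (s - 1) / s - limitMoment r (b - 1) / b) := by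
    rw [intervalIntegral.integral_sub (intervalIntegrable_limitMoment_div r a b) (by simp),
      limitMoment_succ_sub, intervalIntegral.integral_const, smul_eq_mul]
  have h2 : (L + B) * (b - a) ^ 2 = ((L + B) * (b - a)) * |b - a| := by
    rw [abs_of_nonneg (sub_nonneg.2 hab)]; ring
  rw [e, h2, ← Real.norm_eq_abs]
  refine intervalIntegral.norm_integral_le_of_norm_le_const fun s hs => ?_
  rw [Set.uIoc_of_le hab] at hs
  obtain ⟨hs1, hs2⟩ := hs
  have hs0 : 1 < s := by linarith
  have hb0 : 1 < b := by linarith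
  have e2 : limitMoment r (s - 1) / s - limitMoment r (b - 1) / b =
      -((limitMoment r (b - 1) - limitMoment r (s - 1)) / s) +
        limitMoment r (b - 1) * ((b - s) / (s * b)) := by
    have : s ≠ 0 := by linarith
    have : b ≠ 0 := by linarith
    field_simp
    ring
  rw [e2, Real.norm_eq_abs]
  refine (abs_add_le _ _).trans ?_
  rw [abs_neg, abs_div, abs_mul, abs_of_pos (by linarith : 0 < s),
    abs_of_nonneg (div_nonneg (by linarith) (by nlinarith) : 0 ≤ (b - s) / (s * b)), add_mul]
  have l1 := hl (s - 1) (b - 1) (by linarith) (by linarith) (by linarith)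
  have b1 := hb (b - 1) (by linarith)
  refine add_le_add ((div_le_self (abs_nonneg _) hs0.le).trans (l1.trans ?_)) ?_
  · exact mul_le_mul_of_nonneg_left (by linarith) hL
  · gcongr
    refine (div_le_self (by linarith) (by nlinarith)).trans (by linarith)

/-- The error is at most 1/m at N = m. Each further step adds at most C/m² from the previous moment
and K/m² from the rectangle rule, and there are at most Um steps. -/
lemma exists_abs_binomialMoment_sub_le (r : ℕ) (U : ℝ) :
    ∃ D, 0 ≤ D ∧ ∀ m N : ℕ, 0 < m → (N : ℝ) ≤ U * m →
      |binomialMoment m r N - limitMoment r (N / m)| ≤ D / m := by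
  induction r with
  | zero =>
    refine ⟨0, le_rfl, fun m N _ _ => ?_⟩
    rw [limitMoment_zero_of_nonneg (by positivity), binomialMoment]
    simp
  | succ r ih =>
    obtain ⟨C, hC, ihC⟩ := ih
    obtain ⟨K, hK, hKb⟩ := exists_limitMoment_succ_approx r U
    have key : ∀ m N : ℕ, 0 < m → m ≤ N → (N : ℝ) ≤ U * m →
        |binomialMoment m (r + 1) N - limitMoment (r + 1) (N / m)| ≤
          (1 + (C + K) * (N / m)) / m := by
      intro m N hm hN
      have hm' : (0 : ℝ) < m := by exact_mod_cast hm
      induction N, hN using Nat.le_induction with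
      | base =>
        intro _
        have h1 : binomialMoment m (r + 1) m = (m : ℝ)⁻¹ * binomialMoment m r 0 := by
          obtain ⟨m, rfl⟩ := Nat.exists_eq_succ_of_ne_zero hm.ne'
          rw [binomialMoment, Finset.sum_range_succ, Finset.sum_eq_zero]
          · simp
          · intro k hk
            rw [if_neg]
            simpa using hk
        have h2 : |binomialMoment m r 0| ≤ 1 := by
          cases r <;> simp [binomialMoment]
        rw [h1, div_self hm'.ne', limitMoment_succ, intervalIntegral.integral_same, sub_zero,
          abs_mul, abs_of_pos (inv_pos.2 hm'), div_eq_inv_mul]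
        gcongr
        nlinarith
      | succ N hN ihN =>
        intro hU
        push_cast at hU
        have ihN := ihN (by linarith)
        have hmN : (m : ℝ) ≤ N := by exact_mod_cast hN
        have hN0 : (0 : ℝ) < (N : ℝ) + 1 := by positivity
        have h1 : binomialMoment m (r + 1) (N + 1) = binomialMoment m (r + 1) N +
            (N + 1 : ℝ)⁻¹ * binomialMoment m r (N + 1 - m) := by
          rw [binomialMoment, Finset.sum_range_succ, if_pos (by omega), binomialMoment]
        have h2 := hKb (N / m) ((N + 1 : ℕ) / m) ((one_le_div hm').2 hmN) (by gcongr; simp)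
          ((div_le_iff₀ hm').2 (by push_cast; linarith))
        have h3 := ihC m (N + 1 - m) hm (by
          rw [Nat.cast_sub (by omega)]; push_cast; linarith)
        rw [Nat.cast_sub (by omega)] at h3
        have e1 : ((N + 1 : ℕ) : ℝ) / m - N / m = 1 / m := by push_cast; field_simp; ring
        have e2 : ((N + 1 : ℕ) : ℝ) / m - 1 = ((N + 1 : ℕ) - m) / m := by field_simp
        rw [e1, e2] at h2
        set F := limitMoment r ((((N + 1 : ℕ) : ℝ) - m) / m)
        set A := limitMoment (r + 1) (((N + 1 : ℕ) : ℝ) / m)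
        set A' := limitMoment (r + 1) ((N : ℝ) / m)
        set M := binomialMoment m r (N + 1 - m)
        have e3 : 1 / (m : ℝ) * (F / (((N + 1 : ℕ) : ℝ) / m)) = (N + 1 : ℝ)⁻¹ * F := by
          push_cast; field_simp
        rw [e3] at h2
        have h4 : |(N + 1 : ℝ)⁻¹ * (M - F)| ≤ C / m * (1 / m) := by
          rw [abs_mul, abs_of_pos (inv_pos.2 hN0), mul_comm, ← one_div]
          gcongr
          linarith
        have e4 : binomialMoment m (r + 1) (N + 1) - A = (binomialMoment m (r + 1) N - A') +
            (N + 1 : ℝ)⁻¹ * (M - F) - (A - A' - (N + 1 : ℝ)⁻¹ * F) := by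
          rw [h1]; ring
        have e5 : (1 + (C + K) * (((N + 1 : ℕ) : ℝ) / m)) / m =
            (1 + (C + K) * ((N : ℝ) / m)) / m + C / m * (1 / m) + K * (1 / m) ^ 2 := by
          push_cast; field_simp; ring
        rw [e4, e5]
        exact (abs_sub _ _).trans (add_le_add ((abs_add_le _ _).trans (add_le_add ihN h4)) h2)
    refine ⟨1 + (C + K) * |U|, by positivity, fun m N hm hN => ?_⟩
    have hm' : (0 : ℝ) < m := by exact_mod_cast hm
    rcases lt_or_ge N m with h | h
    · rw [binomialMoment_eq_zero m (by nlinarith), limitMoment_of_lt, sub_zero, abs_zero]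
      · positivity
      · have : (N : ℝ) / m < 1 := (div_lt_one hm').2 (by exact_mod_cast h)
        push_cast
        linarith [(r.cast_nonneg : (0 : ℝ) ≤ r)]
    · refine (key m N hm h hN).trans ?_
      gcongr
      exact ((div_le_iff₀ hm').2 hN).trans (le_abs_self U)

lemma tendsto_binomialMoment (r : ℕ) {γ : ℝ} (hγ : 0 < γ) :
    Tendsto (fun n : ℕ => binomialMoment ⌈γ * n⌉₊ r n) atTop (𝓝 (limitMoment r (1 / γ))) := by
  obtain ⟨D, hD, h⟩ := exists_abs_binomialMoment_sub_le r (1 / γ)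
  have hmul : Tendsto (fun n : ℕ => γ * (n : ℝ)) atTop atTop :=
    tendsto_natCast_atTop_atTop.const_mul_atTop hγ
  have hceil : Tendsto (fun n : ℕ => (⌈γ * n⌉₊ : ℝ)) atTop atTop :=
    tendsto_atTop_mono (fun n => Nat.le_ceil _) hmul
  have hratio : Tendsto (fun n : ℕ => (n : ℝ) / ⌈γ * n⌉₊) atTop (𝓝 (1 / γ)) := by
    have h1 : Tendsto (fun n : ℕ => (⌈γ * n⌉₊ : ℝ) / n) atTop (𝓝 γ) :=
      (tendsto_nat_ceil_mul_div_atTop hγ.le).comp tendsto_natCast_atTop_atTop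
    simpa using h1.inv₀ hγ.ne'
  have hlim := (continuousAt_limitMoment r (one_div_pos.2 hγ)).tendsto.comp hratio
  have hzero : Tendsto (fun n : ℕ => binomialMoment ⌈γ * n⌉₊ r n -
      limitMoment r ((n : ℝ) / ⌈γ * n⌉₊)) atTop (𝓝 0) := by
    refine squeeze_zero_norm' ?_ (hceil.const_div_atTop D)
    filter_upwards [eventually_gt_atTop 0] with n hn
    have hn' : (0 : ℝ) < n := by exact_mod_cast hn
    refine h _ n (Nat.ceil_pos.2 (by positivity)) ?_
    rw [one_div, ← div_eq_inv_mul, le_div_iff₀ hγ, mul_comm]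
    exact Nat.le_ceil _
  simpa using hzero.add hlim

/-! ### The limit probabilities and their regularity -/

lemma tendsto_cycleProb (j : ℕ) {R : ℕ} {γ : ℝ} (hγ : 0 < γ) (hR : 1 < R * γ) :
    Tendsto (fun n : ℕ => cycleProb n j γ 1) atTop (𝓝 (∑ r ∈ Finset.range R,
      (-1) ^ (r - j) * (r.choose j : ℝ) * limitMoment r (1 / γ))) := by
  refine (tendsto_finsetSum _ fun r _ => (tendsto_binomialMoment r hγ).const_mul _).congr' ?_
  filter_upwards [eventually_gt_atTop 0] with n hn
  exact (cycleProb_eq_sum hn hγ hR).symm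

lemma P_eq_sum (j : ℕ) {R : ℕ} {γ : ℝ} (hγ : 0 < γ) (hR : 1 < R * γ) :
    P j γ = ∑ r ∈ Finset.range R,
      (-1) ^ (r - j) * (r.choose j : ℝ) * limitMoment r (1 / γ) :=
  (tendsto_cycleProb j hγ hR).limUnder_eq

lemma P_eventuallyEq_sum (j : ℕ) {R : ℕ} {γ : ℝ} (hγ : 0 < γ) (hR : 1 < R * γ) :
    P j =ᶠ[𝓝 γ] fun x => ∑ r ∈ Finset.range R,
      (-1) ^ (r - j) * (r.choose j : ℝ) * limitMoment r (1 / x) := by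
  have h : ∀ᶠ x in 𝓝 γ, 1 < (R : ℝ) * x :=
    (continuousAt_const.mul continuousAt_id).eventually (lt_mem_nhds hR)
  filter_upwards [lt_mem_nhds hγ, h] with x hx hx' using P_eq_sum j hx hx'

lemma contDiffAt_comp_one_div {f : ℝ → ℝ} {γ : ℝ} {n : WithTop ℕ∞} (hγ : 0 < γ)
    (h : ContDiffAt ℝ n f (1 / γ)) : ContDiffAt ℝ n (fun x => f (1 / x)) γ :=
  h.comp (g := f) γ (contDiffAt_const.div contDiffAt_id hγ.ne')

/-- Near `1 / k`, the function `P j` differs by a smooth function from a multiple of the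
`k`-th limit moment. -/
lemma contDiffAt_P_sub (j : ℕ) {k : ℕ} (hk : 0 < k) :
    ContDiffAt ℝ ∞ (fun x => P j x - (-1) ^ (k - j) * (k.choose j : ℝ) * limitMoment k (1 / x))
      (1 / (k : ℝ)) := by
  have hk' : (0 : ℝ) < k := by exact_mod_cast hk
  have hpos : 0 < 1 / (k : ℝ) := one_div_pos.2 hk'
  -- With R = k + 1 the last term is r = k, the only one singular at 1/k.
  have hR : 1 < ((k + 1 : ℕ) : ℝ) * (1 / (k : ℝ)) := by
    push_cast; field_simp; linarith
  have hs : ContDiffAt ℝ ∞ (fun x : ℝ => ∑ r ∈ Finset.range k,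
      (-1) ^ (r - j) * (r.choose j : ℝ) * limitMoment r (1 / x)) (1 / (k : ℝ)) := by
    refine ContDiffAt.sum fun r hr => contDiffAt_const.mul (contDiffAt_comp_one_div hpos ?_)
    refine contDiffAt_limitMoment_of_ne ?_
    rw [one_div_one_div]
    exact_mod_cast (Finset.mem_range.1 hr).ne'
  refine hs.congr_of_eventuallyEq ?_
  filter_upwards [P_eventuallyEq_sum j hpos hR] with x hx
  rw [hx, Finset.sum_range_succ, add_sub_cancel_right]

end LongCycles

open LongCycles in
theorem mainTheorem11 (j : ℕ) :
    (∀ γ : ℝ, 0 < γ →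
      Tendsto (fun n : ℕ => LongCycles.cycleProb n j γ 1) atTop (𝓝 (LongCycles.P j γ))) ∧
    (∀ k : ℕ, 1 ≤ k → j ≤ k →
      ContDiffAt ℝ ((k - 1 : ℕ) : WithTop ℕ∞) (LongCycles.P j) (1 / (k : ℝ)) ∧
      ¬ ContDiffAt ℝ (k : WithTop ℕ∞) (LongCycles.P j) (1 / (k : ℝ))) ∧
    (∀ γ : ℝ, 0 < γ → (∀ k : ℕ, 1 ≤ k → j ≤ k → γ ≠ 1 / (k : ℝ)) →
      ContDiffAt ℝ ∞ (LongCycles.P j) γ) := by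
  have hex : ∀ γ : ℝ, 0 < γ → ∃ R : ℕ, 1 < R * γ := fun γ hγ => by
    obtain ⟨R, hR⟩ := exists_nat_gt (1 / γ)
    exact ⟨R, (div_lt_iff₀ hγ).1 hR⟩
  refine ⟨fun γ hγ => ?_, fun k hk hjk => ?_, fun γ hγ h => ?_⟩
  · obtain ⟨R, hR⟩ := hex γ hγ
    rw [P_eq_sum j hγ hR]
    exact tendsto_cycleProb j hγ hR
  · have hk' : (0 : ℝ) < k := by exact_mod_cast hk
    have hpos : 0 < 1 / (k : ℝ) := one_div_pos.2 hk'
    obtain ⟨r, rfl⟩ := Nat.exists_eq_succ_of_ne_zero (Nat.one_le_iff_ne_zero.1 hk)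
    have hsub := contDiffAt_infty.1 (contDiffAt_P_sub j hk)
    set c : ℝ := (-1) ^ (r.succ - j) * (r.succ.choose j : ℝ) with hc
    have hc0 : c ≠ 0 := mul_ne_zero (by simp) (by exact_mod_cast (Nat.choose_pos hjk).ne')
    constructor
    · have h1 : ContDiffAt ℝ r (fun x : ℝ => limitMoment r.succ (1 / x)) (1 / (r.succ : ℝ)) := by
        refine contDiffAt_comp_one_div hpos ?_
        rw [one_div_one_div]
        exact contDiffAt_limitMoment_self r
      refine ((hsub r).add (contDiffAt_const.mul h1 : ContDiffAt ℝ r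
        (fun x => c * limitMoment r.succ (1 / x)) _)).congr_of_eventuallyEq ?_
      exact Eventually.of_forall fun x => by simp
    · intro hP
      have h1 : ContDiffAt ℝ r.succ (fun x : ℝ => limitMoment r.succ (1 / x))
          (1 / (r.succ : ℝ)) := by
        refine (contDiffAt_const.mul (hP.sub (hsub r.succ)) : ContDiffAt ℝ r.succ
          (fun x => c⁻¹ * (P j x - (P j x - c * limitMoment r.succ (1 / x)))) _).congr_of_eventuallyEq
            (Eventually.of_forall fun x => ?_)
        simp only [sub_sub_cancel]
        rw [inv_mul_cancel_left₀ hc0]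
      refine not_contDiffAt_limitMoment_self r ?_
      -- Inversion is its own inverse, so regularity in γ at 1/k passes back to u = k.
      have := contDiffAt_comp_one_div hk' h1
      simpa only [one_div_one_div] using this
  · obtain ⟨R, hR⟩ := hex γ hγ
    refine ContDiffAt.congr_of_eventuallyEq ?_ (P_eventuallyEq_sum j hγ hR)
    refine ContDiffAt.sum fun r _ => ?_
    rcases lt_or_ge r j with hrj | hrj
    -- For r < j the coefficient is zero, so 1/r is not a singular point of P_j.
    · simpa [Nat.choose_eq_zero_of_lt hrj] using contDiffAt_const
    refine contDiffAt_const.mul (contDiffAt_comp_one_div hγ (contDiffAt_limitMoment_of_ne ?_))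
    intro he
    rcases Nat.eq_zero_or_pos r with rfl | hr
    · simp [hγ.ne'] at he
    · exact h r hr hrj (by rw [← he, one_div_one_div])
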